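/- Let $k,n$ be non-negative integers. A code $C:\{0,1\}^k\to\{0,1\}^n$ is an injective map; its relative distance is $\delta_C=\min_{x\neq y}\Delta(C(x),C(y))$, where $\Delta$ is the fraction of coordinates in which two strings of length $n$ differ. A (randomised) decoder $D$ gets an index $i\in[k]$ and oracle access to $w\in\{0,1\}^n$ and outputs $D^w(i)\in\{0,1,\bot\}$; after its coins are tossed it is a decision tree that queries coordinates of $w$, each query possibly depending on the earlier answers. It is non-adaptive if, once the coins are tossed, the queries do not depend on the answers. For $\ell\in\mathbb N$ and a real number $\delta>0$, $C$ is an $\ell$-query relaxed locally decodable code (relaxed LDC) with decoding radius $\delta$ if $\delta<\delta_C/2$ and there is a decoder $D$ that always makes at most $\ell$ queries and satisfies 1. (Perfect completeness) $D^{C(x)}(i)=x_i$ with probability $1$ for all $x\in\{0,1\}^k$ and $i\in[k]$. 2. (Relaxed decoding) If $\Delta(w,C(x))\le\delta$, then $\Pr[D^w(i)\in\{x_i,\bot\}]\ge 2/3$ for all $i\in[k]$. 3. (Success rate) There is $\rho>0$ such that, whenever $\Delta(w,C(x))\le\delta$, there are at least $\rho k$ indices $i\in[k]$ with $\Pr[D^w(i)=x_i]\ge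 2/3$. **Theorem.** (a) For every $\ell\in\mathbb N$ and $\delta>0$ there is a constant $\alpha=\alpha(\ell,\delta)>0$ such that every $\ell$-query relaxed LDC $C:\{0,1\}^k\to\{0,1\}^n$ with decoding radius $\delta$ satisfies $n=\Omega(k^{1+\alpha})$, i.e. $n\ge c\,k^{1+\alpha}$ for a constant $c=c(\ell,\delta)>0$. (b) Explicitly, there is a function $\ell'=\ell'(\ell)\ge 1$ with integer values and $\ell'=O(2^{\ell}\log\ell)$ as $\ell\to\infty$, such that for every $\ell$ and $\delta>0$ every such code satisfies $n=\Omega\big(k^{2\ell'^2/(2\ell'^2-1)}\big)=\Omega\big(k^{1+1/(2\ell'^2-1)}\big)$, where the implied constant depends only on $\ell$ and $\delta$. (c) For non-adaptive decoders one can take $\alpha=1/O(\ell^2)$: there is a positive function $A(\ell)=O(\ell^2)$ such that for every $\ell$ and $\delta>0$ every $\ell$-query relaxed LDC with decoding radius $\delta$ and a non-adaptive decoder satisfies $n=\Omega(k^{1+1/A(\ell)})$, where the implied constant depends only on $\ell$ and $\delta$. (d) Hence $O(1)$-query relaxed LDCs cannot have blocklength $k^{1+o(1)}$: for fixed $\ell$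 and $\delta>0$ there are no $\ell$-query relaxed LDCs $C_m:\{0,1\}^{k_m}\to\{0,1\}^{n_m}$ ($m\in\mathbb N$) with decoding radius $\delta$, $k_m\to\infty$ and $n_m\le k_m^{1+\varepsilon_m}$ with $\varepsilon_m\to0$. -/

import Mathlib

open Filter Topology Asymptotics

namespace RLDC

/-- Binary strings of length `m`. -/
abbrev Str (m : ℕ) : Type := Fin m → Bool

/-- Relative Hamming distance of two strings of length `n`: the fraction of coordinates in which
they differ. -/
noncomputable def relDist {n : ℕ} (x y : Str n) : ℝ := (hammingDist x y : ℝ) / n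

/-- A deterministic (in general adaptive) query algorithm with oracle access to a string of
length `n`. A leaf carries the output: `some b` is the bit `b`, and `none` is the reject
symbol `⊥`. An inner node `node j t₀ t₁` queries coordinate `j` and goes on with `t₀` if the
answer is `0` and with `t₁` if the answer is `1`. -/
inductive DecisionTree (n : ℕ) : Type
  | leaf (out : Option Bool) : DecisionTree n
  | node (j : Fin n) (t₀ t₁ : DecisionTree n) : DecisionTree n

/-- The output of the algorithm on the oracle `w`. -/
def DecisionTree.eval {n : ℕ} (w : Str n) : DecisionTree n → Option Bool
  | .leaf out => out
  | .node j t₀ t₁ => if w j then t₁.eval w else t₀.eval w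

/-- The sequence of queries that the algorithm makes on the oracle `w`. -/
def DecisionTree.queries {n : ℕ} (w : Str n) : DecisionTree n → List (Fin n)
  | .leaf _ => []
  | .node j t₀ t₁ => j :: (if w j then t₁.queries w else t₀.queries w)

/-- A randomised local decoder for messages of length `k` and words of length `n`: for every
message index `i`, the coin tosses select a deterministic query algorithm. -/
abbrev LocalDecoder (k n : ℕ) : Type := Fin k → PMF (DecisionTree n)

/-- The distribution of the output `D^w(i)` over the coin tosses of the decoder. -/
noncomputable def LocalDecoder.output {k n : ℕ} (D : LocalDecoder k n) (w : Str n) (i : Fin k) :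
    PMF (Option Bool) :=
  (D i).map (DecisionTree.eval w)

/-- The decoder always makes at most `ℓ` queries. -/
def LocalDecoder.HasLocality {k n : ℕ} (D : LocalDecoder k n) (ℓ : ℕ) : Prop :=
  ∀ i, ∀ t ∈ (D i).support, ∀ w : Str n, (t.queries w).length ≤ ℓ

/-- The decoder is non-adaptive: once the coins are tossed, the queries do not depend on the
answers. -/
def LocalDecoder.IsNonadaptive {k n : ℕ} (D : LocalDecoder k n) : Prop :=
  ∀ i, ∀ t ∈ (D i).support, ∀ w w' : Str n, t.queries w = t.queries w'

/-- `D` is a relaxed decoder for `C` with decoding radius `δ`. -/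
structure IsRelaxedDecoder {k n : ℕ} (C : Str k → Str n) (δ : ℝ) (D : LocalDecoder k n) :
    Prop where
  /-- Perfect completeness. -/
  completeness : ∀ (x : Str k) (i : Fin k), D.output (C x) i (some (x i)) = 1
  /-- Relaxed decoding: on words close to `C x`, the decoder outputs `x i` or rejects, with
  probability at least `2/3`. -/
  relaxed_decoding : ∀ (x : Str k) (w : Str n), relDist w (C x) ≤ δ → ∀ i : Fin k,
    2 / 3 ≤ D.output w i (some (x i)) + D.output w i none
  /-- Success rate: on words close to `C x`, the decoder outputs `x i` with probability at
  least `2/3` for a constant fraction of the indices. -/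
  success_rate : ∃ ρ : ℝ, 0 < ρ ∧ ∀ (x : Str k) (w : Str n), relDist w (C x) ≤ δ →
    ∃ I : Finset (Fin k), ρ * k ≤ I.card ∧ ∀ i ∈ I, 2 / 3 ≤ D.output w i (some (x i))

/-- `C` is a code for which `δ` is an admissible decoding radius: `C` is injective and `δ` is
positive and less than half of the relative distance `min_{x ≠ y} relDist (C x) (C y)`. -/
structure IsCodeWithRadius {k n : ℕ} (C : Str k → Str n) (δ : ℝ) : Prop where
  injective : Function.Injective C
  radius_pos : 0 < δ
  radius_lt : ∀ x y : Str k, x ≠ y → δ < relDist (C x) (C y) / 2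

/-- `C` is an `ℓ`-local relaxed locally decodable code with decoding radius `δ`. -/
def IsRelaxedLDC {k n : ℕ} (C : Str k → Str n) (ℓ : ℕ) (δ : ℝ) : Prop :=
  IsCodeWithRadius C δ ∧
    ∃ D : LocalDecoder k n, IsRelaxedDecoder C δ D ∧ D.HasLocality ℓ

/-- `C` is an `ℓ`-local relaxed locally decodable code with decoding radius `δ` and a
non-adaptive decoder. -/
def IsNonadaptiveRelaxedLDC {k n : ℕ} (C : Str k → Str n) (ℓ : ℕ) (δ : ℝ) : Prop :=
  IsCodeWithRadius C δ ∧
    ∃ D : LocalDecoder k n, IsRelaxedDecoder C δ D ∧ D.HasLocality ℓ ∧ D.IsNonadaptive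

end RLDC

/-! The message is determined by a random sample of codeword coordinates much smaller than the
codeword, and counting then bounds `k`. Once the coins are tossed, the output depends on at most `q`
coordinates: `2 ^ ℓ` for a whole adaptive tree, `ℓ` for a non-adaptive one.

Sample `R` by keeping each coordinate with probability `1 / N`. The trees for index `i` may share a
few popular coordinates that `R` is likely to miss. These go into a kernel `K i` whose values are
guessed. `exists_kernel` picks the popularity threshold so that for any event of probability at
least `2 / 3`, some tree in it reads only `R ∪ K i`, with failure probability small enough to
survive a union bound over all `2 ^ |K i|` guesses and all `i`.

If `|K i| ≤ δ n`, then `C x` with any guess written on `K i` stays within the decoding radius, so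
with probability at least `2 / 3` the decoder does not output the wrong bit. Hence a typical `R`
contains, for every guess, a tree refuting the wrong value of `x i`. The guess taken from another
codeword `C y` that agrees with `C x` on `R` would, by perfect completeness, make that tree output
`y i`. So `x = y`, and `R` determines at most `2 ^ |R|` messages (`card_determines_le`).

Averaging over `R` gives `2 ^ k / 2 ≤ (1 + 1 / N) ^ n ≤ exp (n / N)`, so `k = O(n / N)`. The kernel
bound permits `N = n ^ (1 / (4 q ^ 2 + 1))`, which yields the exponent `1 + 1 / (4 q ^ 2)`. -/

namespace RLDC

/-! ### Query sets of decision trees -/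

namespace DecisionTree

variable {n : ℕ}

theorem eval_congr {w w' : Str n} (t : DecisionTree n)
    (h : ∀ j ∈ t.queries w, w j = w' j) : t.eval w = t.eval w' := by
  induction t with
  | leaf out => rfl
  | node j t₀ t₁ ih₀ ih₁ =>
    have hj : w j = w' j := h j (by simp [queries])
    simp only [eval, ← hj]
    rcases hwj : w j with _ | _
    · simpa using ih₀ fun v hv => h v (by simp [queries, hwj, hv])
    · simpa using ih₁ fun v hv => h v (by simp [queries, hwj, hv])

open Classical in
/-- The coordinates that are queried on some oracle. -/
noncomputable def coords (t : DecisionTree n) : Finset (Fin n) :=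
  Finset.univ.filter fun j => ∃ w, j ∈ t.queries w

theorem mem_coords {t : DecisionTree n} {j : Fin n} :
    j ∈ t.coords ↔ ∃ w, j ∈ t.queries w := by
  simp [coords]

theorem eval_congr_coords {w w' : Str n} (t : DecisionTree n)
    (h : ∀ j ∈ t.coords, w j = w' j) : t.eval w = t.eval w' :=
  t.eval_congr fun j hj => h j (mem_coords.2 ⟨w, hj⟩)

theorem card_coords_le_of_nonadaptive {t : DecisionTree n} {ℓ : ℕ}
    (h : ∀ w w' : Str n, t.queries w = t.queries w')
    (hℓ : ∀ w : Str n, (t.queries w).length ≤ ℓ) : t.coords.card ≤ ℓ := by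
  have hsub : t.coords ⊆ (t.queries fun _ => false).toFinset := by
    intro j hj
    obtain ⟨w, hw⟩ := mem_coords.1 hj
    rw [List.mem_toFinset, h _ w]
    exact hw
  exact (Finset.card_le_card hsub).trans ((List.toFinset_card_le _).trans (hℓ _))

/-- On a set of oracles on which the tree makes at most `ℓ` queries, it visits fewer than `2 ^ ℓ`
coordinates altogether. -/
theorem exists_queries_subset (t : DecisionTree n) (P : Set (Str n)) (ℓ : ℕ)
    (hℓ : ∀ w ∈ P, (t.queries w).length ≤ ℓ) :
    ∃ U : Finset (Fin n), U.card + 1 ≤ 2 ^ ℓ ∧ ∀ w ∈ P, ∀ j ∈ t.queries w, j ∈ U := by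
  induction t generalizing P ℓ with
  | leaf out => exact ⟨∅, by simpa using Nat.one_le_two_pow, by simp [queries]⟩
  | node j t₀ t₁ ih₀ ih₁ =>
    rcases P.eq_empty_or_nonempty with rfl | ⟨w₀, hw₀⟩
    · exact ⟨∅, by simpa using Nat.one_le_two_pow, by simp⟩
    obtain ⟨m, rfl⟩ : ∃ m, ℓ = m + 1 := by
      have := hℓ w₀ hw₀
      simp only [queries, List.length_cons] at this
      exact ⟨ℓ - 1, by omega⟩
    -- Only oracles answering `false` at `j` reach `t₀`; on others its query count is uncontrolled.
    -- This is why the induction carries the set `P`.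
    obtain ⟨U₀, hU₀, h₀⟩ := ih₀ {w ∈ P | w j = false} m (by
      rintro w ⟨hw, hwj⟩
      simpa [queries, hwj] using hℓ w hw)
    obtain ⟨U₁, hU₁, h₁⟩ := ih₁ {w ∈ P | w j = true} m (by
      rintro w ⟨hw, hwj⟩
      simpa [queries, hwj] using hℓ w hw)
    refine ⟨insert j (U₀ ∪ U₁), ?_, ?_⟩
    · have h1 := Finset.card_insert_le j (U₀ ∪ U₁)
      have h2 := Finset.card_union_le U₀ U₁
      rw [pow_succ]
      omega
    · intro w hw v hv
      rcases hwj : w j with _ | _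
      · simp only [queries, hwj, List.mem_cons] at hv
        rcases hv with rfl | hv
        · simp
        · simp [h₀ w ⟨hw, hwj⟩ v (by simpa using hv)]
      · simp only [queries, hwj, List.mem_cons] at hv
        rcases hv with rfl | hv
        · simp
        · simp [h₁ w ⟨hw, hwj⟩ v (by simpa using hv)]

theorem card_coords_le_two_pow {t : DecisionTree n} {ℓ : ℕ}
    (hℓ : ∀ w : Str n, (t.queries w).length ≤ ℓ) : t.coords.card ≤ 2 ^ ℓ := by
  obtain ⟨U, hU, h⟩ := t.exists_queries_subset Set.univ ℓ fun w _ => hℓ w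
  have hsub : t.coords ⊆ U := fun j hj => by
    obtain ⟨w, hw⟩ := mem_coords.1 hj
    exact h w trivial j hw
  have := Finset.card_le_card hsub
  omega

end DecisionTree

/-! ### Random subsets -/

section RandomSubset

variable {V : Type*} [Fintype V]

/-- The expectation of `F` over a random subset that contains each element independently with
probability `p`. -/
noncomputable def subsetExp (p : ℝ) (F : Finset V → ℝ) : ℝ :=
  ∑ R : Finset V, p ^ R.card * (1 - p) ^ (Fintype.card V - R.card) * F R

theorem subsetExp_mono {p : ℝ} (hp₀ : 0 ≤ p) (hp₁ : p ≤ 1) {F G : Finset V → ℝ}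
    (h : ∀ R, F R ≤ G R) : subsetExp p F ≤ subsetExp p G := by
  refine Finset.sum_le_sum fun R _ => mul_le_mul_of_nonneg_left (h R) ?_
  have : 0 ≤ 1 - p := by linarith
  positivity

theorem subsetExp_sub (p : ℝ) (F G : Finset V → ℝ) :
    subsetExp p (fun R => F R - G R) = subsetExp p F - subsetExp p G := by
  simp only [subsetExp, mul_sub, Finset.sum_sub_distrib]

theorem subsetExp_sum {ι : Type*} (p : ℝ) (s : Finset ι) (F : ι → Finset V → ℝ) :
    subsetExp p (fun R => ∑ a ∈ s, F a R) = ∑ a ∈ s, subsetExp p (F a) := by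
  simp only [subsetExp, Finset.mul_sum]
  exact Finset.sum_comm

theorem subsetExp_two_pow_card (p : ℝ) :
    subsetExp p (fun R : Finset V => (2 : ℝ) ^ R.card) = (1 + p) ^ Fintype.card V := by
  have h := Finset.sum_pow_mul_eq_add_pow (2 * p) (1 - p) (Finset.univ : Finset V)
  rw [Finset.powerset_univ, Finset.card_univ] at h
  rw [show 1 + p = 2 * p + (1 - p) by ring, ← h]
  refine Finset.sum_congr rfl fun R _ => ?_
  rw [mul_pow]
  ring

variable [DecidableEq V]

/-- Expanding the product of `p + c v`, with `c v = 0` on `U` and `1 - p` off it, leaves exactly the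
weights of the sets `R ⊇ U`. -/
theorem subsetExp_superset (p : ℝ) (U : Finset V) :
    subsetExp p (fun R => if U ⊆ R then 1 else 0) = p ^ U.card := by
  have h := Finset.prod_add (fun _ : V => p) (fun v => if v ∈ U then 0 else 1 - p) Finset.univ
  have hl : ∏ v : V, (p + if v ∈ U then 0 else 1 - p) = p ^ U.card := by
    rw [← Finset.prod_const, ← Finset.prod_subset (Finset.subset_univ U)]
    · exact Finset.prod_congr rfl fun v hv => by simp [hv]
    · intro v _ hv
      simp [hv]
  rw [hl, Finset.powerset_univ] at h
  rw [h]
  refine Finset.sum_congr rfl fun R _ => ?_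
  rw [Finset.prod_const, mul_assoc]
  congr 1
  beta_reduce
  split_ifs with hU
  · rw [mul_one, ← Finset.card_univ, ← Finset.card_sdiff_of_subset (Finset.subset_univ R),
      ← Finset.prod_const]
    refine Finset.prod_congr rfl fun v hv => ?_
    rw [if_neg fun hvU => (Finset.mem_sdiff.1 hv).2 (hU hvU)]
  · obtain ⟨v, hvU, hvR⟩ := Finset.not_subset.1 hU
    rw [mul_zero]
    exact (Finset.prod_eq_zero (i := v) (by simp [hvR]) (by simp [hvU])).symm

theorem subsetExp_const (p : ℝ) (a : ℝ) : subsetExp p (fun _ : Finset V => a) = a := by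
  have h := subsetExp_superset p (∅ : Finset V)
  simp only [subsetExp, Finset.empty_subset, if_true, Finset.card_empty, pow_zero, mul_one] at h
  rw [subsetExp, ← Finset.sum_mul, h, one_mul]

/-- The events that a random set contains the members of a disjoint family are independent. -/
theorem subsetExp_superset_mul_prod (p : ℝ) (𝓜 : Finset (Finset V))
    (h𝓜 : (𝓜 : Set (Finset V)).PairwiseDisjoint id) (U : Finset V)
    (hU : ∀ T ∈ 𝓜, Disjoint U T) :
    subsetExp p (fun R => (if U ⊆ R then 1 else 0) * ∏ T ∈ 𝓜, (1 - if T ⊆ R then 1 else 0)) =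
      p ^ U.card * ∏ T ∈ 𝓜, (1 - p ^ T.card) := by
  induction 𝓜 using Finset.induction_on generalizing U with
  | empty => simpa using subsetExp_superset p U
  | insert T 𝓜 hT ih =>
    have hd : ∀ T' ∈ 𝓜, Disjoint T T' := fun T' hT' =>
      h𝓜 (by simp) (by simp [hT']) (by rintro rfl; exact hT hT')
    have h𝓜' : (𝓜 : Set (Finset V)).PairwiseDisjoint id :=
      h𝓜.subset (by simp)
    -- The factor for `T` splits the expectation into the one for `U` minus the one for `U ∪ T`.
    have h1 := ih h𝓜' U fun T' hT' => hU T' (by simp [hT'])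
    have h2 := ih h𝓜' (U ∪ T) fun T' hT' =>
      Finset.disjoint_union_left.2 ⟨hU T' (by simp [hT']), hd T' hT'⟩
    have hUT : (U ∪ T).card = U.card + T.card :=
      Finset.card_union_of_disjoint (hU T (by simp))
    rw [Finset.prod_insert hT, show p ^ U.card * ((1 - p ^ T.card) * ∏ T ∈ 𝓜, (1 - p ^ T.card)) =
      p ^ U.card * ∏ T ∈ 𝓜, (1 - p ^ T.card) -
        p ^ (U ∪ T).card * ∏ T ∈ 𝓜, (1 - p ^ T.card) by rw [hUT]; ring, ← h1, ← h2,
      ← subsetExp_sub]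
    congr 1
    funext R
    rw [Finset.prod_insert hT]
    by_cases hUR : U ⊆ R <;> by_cases hTR : T ⊆ R <;>
      simp [hUR, hTR, Finset.union_subset_iff]

/-- `F` stands for the indicator of failure, possible only if `R` contains no member of `𝓜`.
Disjoint members are missed independently, each with probability at most `1 - p ^ q`. -/
theorem subsetExp_no_superset_le {p : ℝ} (hp₀ : 0 ≤ p) (hp₁ : p ≤ 1) {q : ℕ}
    (𝓜 : Finset (Finset V)) (h𝓜 : (𝓜 : Set (Finset V)).PairwiseDisjoint id)
    (hq : ∀ T ∈ 𝓜, T.card ≤ q) {F : Finset V → ℝ} (hF₁ : ∀ R, F R ≤ 1)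
    (hF₀ : ∀ R, ∀ T ∈ 𝓜, T ⊆ R → F R ≤ 0) :
    subsetExp p F ≤ Real.exp (-(p ^ q * 𝓜.card)) := by
  have h := subsetExp_superset_mul_prod p 𝓜 h𝓜 ∅ (by simp)
  simp only [Finset.empty_subset, if_true, one_mul, Finset.card_empty, pow_zero] at h
  calc subsetExp p F ≤ subsetExp p fun R => ∏ T ∈ 𝓜, (1 - if T ⊆ R then 1 else 0) := by
        refine subsetExp_mono hp₀ hp₁ fun R => ?_
        by_cases hR : ∃ T ∈ 𝓜, T ⊆ R
        · obtain ⟨T, hT, hTR⟩ := hR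
          rw [Finset.prod_eq_zero hT (by simp [hTR])]
          exact hF₀ R T hT hTR
        · push Not at hR
          rw [Finset.prod_eq_one fun T hT => by simp [hR T hT]]
          exact hF₁ R
    _ = ∏ T ∈ 𝓜, (1 - p ^ T.card) := h
    _ ≤ ∏ _T ∈ 𝓜, Real.exp (-p ^ q) := by
        refine Finset.prod_le_prod (fun T _ => ?_) fun T hT => ?_
        · linarith [pow_le_one₀ (n := T.card) hp₀ hp₁]
        · have h1 : p ^ q ≤ p ^ T.card := pow_le_pow_of_le_one hp₀ hp₁ (hq T hT)
          have h2 := Real.add_one_le_exp (-p ^ q)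
          linarith
    _ = Real.exp (-(p ^ q * 𝓜.card)) := by
        rw [Finset.prod_const, ← Real.exp_nat_mul]
        ring_nf

end RandomSubset

/-! ### Probabilities of events under a probability mass function -/

section Prob

variable {Ω : Type*} (P : PMF Ω)

/-- The probability of an event, as a real number. -/
noncomputable def prob (s : Set Ω) : ℝ := (P.toOuterMeasure s).toReal

theorem toOuterMeasure_le_one (s : Set Ω) : P.toOuterMeasure s ≤ 1 := by
  rw [PMF.toOuterMeasure_apply, ← P.tsum_coe]
  exact ENNReal.tsum_le_tsum fun t => Set.indicator_le_self _ _ t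

theorem toOuterMeasure_ne_top (s : Set Ω) : P.toOuterMeasure s ≠ ⊤ :=
  ((toOuterMeasure_le_one P s).trans_lt ENNReal.one_lt_top).ne

theorem prob_nonneg (s : Set Ω) : 0 ≤ prob P s := ENNReal.toReal_nonneg

theorem prob_mono {s s' : Set Ω} (h : s ∩ P.support ⊆ s') : prob P s ≤ prob P s' :=
  ENNReal.toReal_mono (toOuterMeasure_ne_top P s') (P.toOuterMeasure_mono h)

theorem prob_union_le (s s' : Set Ω) : prob P (s ∪ s') ≤ prob P s + prob P s' := by
  rw [prob, prob, prob, ← ENNReal.toReal_add (toOuterMeasure_ne_top P s)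
    (toOuterMeasure_ne_top P s')]
  exact ENNReal.toReal_mono (ENNReal.add_ne_top.2 ⟨toOuterMeasure_ne_top P s,
    toOuterMeasure_ne_top P s'⟩) (MeasureTheory.measure_union_le s s')

theorem prob_biUnion_le {ι : Type*} (A : Finset ι) (E : ι → Set Ω) :
    prob P (⋃ a ∈ A, E a) ≤ ∑ a ∈ A, prob P (E a) := by
  simp only [prob]
  rw [← ENNReal.toReal_sum fun a _ => toOuterMeasure_ne_top P (E a)]
  exact ENNReal.toReal_mono (ENNReal.sum_ne_top.2 fun a _ => toOuterMeasure_ne_top P (E a))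
    (MeasureTheory.measure_biUnion_finset_le A E)

/-- If no outcome lies in more than `q` of the events, then their probabilities sum up to at most
`q`. -/
theorem sum_prob_le {ι : Type*} (A : Finset ι) (E : ι → Set Ω) (q : ℕ)
    (h : ∀ t ∈ P.support, ∀ A' ⊆ A, (∀ a ∈ A', t ∈ E a) → A'.card ≤ q) :
    ∑ a ∈ A, prob P (E a) ≤ q := by
  classical
  simp only [prob]
  rw [← ENNReal.toReal_sum fun a _ => toOuterMeasure_ne_top P (E a)]
  refine ENNReal.toReal_le_of_le_ofReal (Nat.cast_nonneg q) ?_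
  rw [ENNReal.ofReal_natCast]
  simp only [PMF.toOuterMeasure_apply]
  rw [← Summable.tsum_finsetSum fun _ _ => ENNReal.summable]
  calc ∑' t, ∑ a ∈ A, (E a).indicator P t ≤ ∑' t, P t * q := by
        refine ENNReal.tsum_le_tsum fun t => ?_
        by_cases ht : t ∈ P.support
        · simp only [Set.indicator_apply]
          rw [← Finset.sum_filter, Finset.sum_const, nsmul_eq_mul, mul_comm]
          gcongr
          exact h t ht _ (Finset.filter_subset _ _) fun a ha => (Finset.mem_filter.1 ha).2
        · rw [PMF.mem_support_iff, not_not] at ht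
          simp [Set.indicator_apply, ht]
    _ = q := by rw [ENNReal.tsum_mul_right, P.tsum_coe, one_mul]

end Prob

/-! ### Kernels of random sets -/

section Kernel

variable {Ω V : Type*} [DecidableEq V]

/-- Given a family of sets, none of which is empty, there is a disjoint subfamily whose union meets
every set of the family. -/
theorem exists_disjoint_family_meeting (𝓣 : Finset (Finset V)) (h𝓣 : ∅ ∉ 𝓣) :
    ∃ 𝓜 ⊆ 𝓣, (𝓜 : Set (Finset V)).PairwiseDisjoint id ∧
      ∀ T ∈ 𝓣, ∃ T' ∈ 𝓜, ¬ Disjoint T T' := by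
  classical
  obtain ⟨𝓜, h𝓜, hmax⟩ := Finset.exists_max_image
    (𝓣.powerset.filter fun 𝓜 : Finset (Finset V) => (𝓜 : Set (Finset V)).PairwiseDisjoint id) Finset.card
    ⟨∅, by simp⟩
  rw [Finset.mem_filter, Finset.mem_powerset] at h𝓜
  refine ⟨𝓜, h𝓜.1, h𝓜.2, fun T hT => ?_⟩
  by_contra! hd
  -- A nonempty set meets itself, so a set disjoint from all members is a new one and would enlarge
  -- the maximal family.
  have hT𝓜 : T ∉ 𝓜 := fun h => by
    have := hd T h
    rw [disjoint_self, Finset.bot_eq_empty] at this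
    exact h𝓣 (this ▸ hT)
  have hins := hmax (insert T 𝓜) (by
    rw [Finset.mem_filter, Finset.mem_powerset]
    refine ⟨Finset.insert_subset hT h𝓜.1, ?_⟩
    rw [Finset.coe_insert]
    exact h𝓜.2.insert fun T' hT' _ => hd T' hT')
  rw [Finset.card_insert_of_notMem hT𝓜] at hins
  omega

/-- A chain `K 0 ⊆ K 1 ⊆ …` has a layer `K (j + 1) \ K j` with `j < 4 * q` that a random set with
at most `q` elements rarely meets. -/
theorem exists_layer_prob_le (P : PMF Ω) (S : Ω → Finset V) {q : ℕ} (hq : 1 ≤ q)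
    (hS : ∀ t ∈ P.support, (S t).card ≤ q) (K : ℕ → Finset V) (hK : Monotone K) :
    ∃ j < 4 * q, prob P {t | ¬ Disjoint (S t) (K (j + 1) \ K j)} ≤ 1 / 4 := by
  classical
  by_contra! hlt
  -- The layers are disjoint, so `S t` meets at most `q` of them; if each of the `4 * q` were met
  -- with probability above `1 / 4`, the sum would exceed `q`.
  have hsum := sum_prob_le P (Finset.range (4 * q))
    (fun j => {t | ¬ Disjoint (S t) (K (j + 1) \ K j)}) q (by
      intro t ht A' _ hA'
      refine le_trans ?_ (hS t ht)
      have hex : ∀ j, ¬ Disjoint (S t) (K (j + 1) \ K j) → ∃ v ∈ S t, v ∈ K (j + 1) \ K j :=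
        fun j hj => Finset.not_disjoint_iff.1 hj
      rcases A'.eq_empty_or_nonempty with rfl | ⟨j₀, hj₀⟩
      · simp
      have : Nonempty V := (hex j₀ (hA' j₀ hj₀)).nonempty
      choose! f hf using hex
      refine Finset.card_le_card_of_injOn f (fun j hj => ?_) fun j hj j' hj' hjj' => ?_
      · exact (hf j (hA' j hj)).1
      · have h1 := (hf j (hA' j hj)).2
        have h2 := (hf j' (hA' j' hj')).2
        rw [← hjj'] at h2
        rw [Finset.mem_sdiff] at h1 h2
        by_contra hne
        rcases Nat.lt_or_gt_of_ne hne with h | h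
        · exact h2.2 (hK (Nat.succ_le_of_lt h) h1.1)
        · exact h1.2 (hK (Nat.succ_le_of_lt h) h2.1))
  have hgt : ∑ _j ∈ Finset.range (4 * q), (1 / 4 : ℝ) <
      ∑ j ∈ Finset.range (4 * q), prob P {t | ¬ Disjoint (S t) (K (j + 1) \ K j)} :=
    Finset.sum_lt_sum_of_nonempty ⟨0, by simp; omega⟩ fun j hj => hlt j (Finset.mem_range.1 hj)
  rw [Finset.sum_const, Finset.card_range, nsmul_eq_mul] at hgt
  push_cast at hgt
  linarith

variable [Fintype V]

/-- If a random set with at most `q` elements contains no element outside `K'` with probability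
more than `d⁻¹`, and avoids `K' \ K` on an event `G`, then a random subset together with `K`
contains one of the sets `S t` with `t ∈ G`, except with small probability. -/
theorem subsetExp_no_cover_le (P : PMF Ω) (S : Ω → Finset V) {q : ℕ} (hq : 1 ≤ q)
    (hS : ∀ t ∈ P.support, (S t).card ≤ q) {p : ℝ} (hp₀ : 0 < p) (hp₁ : p ≤ 1)
    (K K' : Finset V) {d : ℝ} (hd : 0 < d) (hK' : ∀ v ∉ K', d * prob P {t | v ∈ S t} ≤ 1)
    (G : Set Ω) (hGS : G ⊆ P.support) (hG : 5 / 12 ≤ prob P G)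
    (hGK : ∀ t ∈ G, Disjoint (S t) (K' \ K)) {F : Finset V → ℝ} (hF₁ : ∀ R, F R ≤ 1)
    (hF₀ : ∀ R, ∀ t ∈ G, S t ⊆ R ∪ K → F R ≤ 0) :
    subsetExp p F ≤ Real.exp (-(p ^ q * (5 * d / (12 * q)))) := by
  classical
  have hq0 : (0 : ℝ) < q := by exact_mod_cast hq
  set 𝓣 : Finset (Finset V) := Finset.univ.filter fun T => ∃ t ∈ G, S t \ K = T with h𝓣
  have hcov : ∀ R, ∀ T ∈ 𝓣, T ⊆ R → F R ≤ 0 := by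
    intro R T hT hTR
    obtain ⟨t, ht, rfl⟩ := (Finset.mem_filter.1 hT).2
    exact hF₀ R t ht (by rw [Finset.union_comm]; exact sdiff_le_iff.1 hTR)
  -- Here some `S t` with `t ∈ G` lies inside `K`, so every `R` succeeds.
  by_cases h0 : ∅ ∈ 𝓣
  · calc subsetExp p F ≤ subsetExp p fun _ => 0 :=
          subsetExp_mono hp₀.le hp₁ fun R => hcov R ∅ h0 (Finset.empty_subset R)
      _ = 0 := subsetExp_const p 0
      _ ≤ _ := (Real.exp_pos _).le
  obtain ⟨𝓜, h𝓜, hdisj, hmeet⟩ := exists_disjoint_family_meeting 𝓣 h0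
  have hcard : ∀ T ∈ 𝓜, T.card ≤ q := by
    intro T hT
    obtain ⟨t, ht, rfl⟩ := (Finset.mem_filter.1 (h𝓜 hT)).2
    exact (Finset.card_le_card Finset.sdiff_subset).trans (hS t (hGS ht))
  refine (subsetExp_no_superset_le hp₀.le hp₁ 𝓜 hdisj hcard hF₁
    fun R T hT => hcov R T (h𝓜 hT)).trans ?_
  rw [Real.exp_le_exp, neg_le_neg_iff]
  refine mul_le_mul_of_nonneg_left ?_ (by positivity)
  set U := 𝓜.biUnion id \ K' with hU
  have hUcard : (U.card : ℝ) ≤ 𝓜.card * q := by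
    have h1 : (𝓜.biUnion id).card ≤ 𝓜.card * q := Finset.card_biUnion_le_card_mul _ _ _ hcard
    exact_mod_cast (Finset.card_le_card Finset.sdiff_subset).trans h1
  -- Every `S t` with `t ∈ G` meets `U`, whose elements are unpopular; hence `U`, and with it `𝓜`,
  -- must be large.
  have hsub : G ∩ P.support ⊆ ⋃ v ∈ U, {t | v ∈ S t} := by
    rintro t ⟨ht, -⟩
    obtain ⟨T, hT, hnd⟩ := hmeet (S t \ K) (Finset.mem_filter.2 ⟨Finset.mem_univ _, t, ht, rfl⟩)
    obtain ⟨v, hv, hvT⟩ := Finset.not_disjoint_iff.1 hnd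
    rw [Finset.mem_sdiff] at hv
    simp only [Set.mem_iUnion]
    refine ⟨v, ?_, hv.1⟩
    rw [hU, Finset.mem_sdiff]
    exact ⟨Finset.mem_biUnion.2 ⟨T, hT, hvT⟩, fun hvK' =>
      Finset.disjoint_left.1 (hGK t ht) hv.1 (Finset.mem_sdiff.2 ⟨hvK', hv.2⟩)⟩
  have hle : d * (5 / 12) ≤ U.card := by
    calc d * (5 / 12) ≤ d * ∑ v ∈ U, prob P {t | v ∈ S t} :=
          mul_le_mul_of_nonneg_left
            (hG.trans ((prob_mono P hsub).trans (prob_biUnion_le P _ _))) hd.le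
      _ = ∑ v ∈ U, d * prob P {t | v ∈ S t} := Finset.mul_sum _ _ _
      _ ≤ ∑ _v ∈ U, 1 := Finset.sum_le_sum fun v hv => hK' v (Finset.mem_sdiff.1 hv).2
      _ = U.card := by simp
  rw [div_le_iff₀ (by positivity)]
  linarith

/-- A random set `S` with at most `q` elements has a small kernel `K`: for every event `G` of
probability at least `2 / 3`, a random subset together with `K` contains one of the sets `S t`
with `t ∈ G`, except with a probability that is small even in comparison with `2 ^ (-|K|)`. -/
theorem exists_kernel (P : PMF Ω) (S : Ω → Finset V) {q : ℕ} (hq : 1 ≤ q)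
    (hS : ∀ t ∈ P.support, (S t).card ≤ q) {N : ℝ} (hN : 1 ≤ N) :
    ∃ K : Finset V, (K.card : ℝ) ≤ q * (N * (5 * q ^ 2 * N ^ q) ^ (4 * q - 1)) ∧
      ∀ G : Set Ω, 2 / 3 ≤ prob P G → ∀ F : Finset V → ℝ, (∀ R, F R ≤ 1) →
        (∀ R, ∀ t ∈ G, t ∈ P.support → S t ⊆ R ∪ K → F R ≤ 0) →
        2 ^ K.card * subsetExp N⁻¹ F ≤ Real.exp (-N) := by
  classical
  have hq1 : (1 : ℝ) ≤ q := by exact_mod_cast hq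
  have hN0 : 0 < N := by linarith
  -- The ratio of successive thresholds: `N ^ q` cancels the chance that `R` contains a given
  -- `q`-set, and `5 * q ^ 2` makes the failure exponent exceed twice the bound `q * d j` on the
  -- kernel size.
  set B : ℝ := 5 * q ^ 2 * N ^ q with hB
  have hB1 : 1 ≤ B := by
    have h1 : (1 : ℝ) ≤ q ^ 2 := one_le_pow₀ hq1
    have h2 : 1 ≤ N ^ q := one_le_pow₀ hN
    rw [hB]
    nlinarith
  set d : ℕ → ℝ := fun j => N * B ^ j with hd
  have hdmono : Monotone d := fun a b hab => by
    simp only [hd]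
    gcongr
  have hd0 : ∀ j, 0 < d j := fun j => by
    have : 0 < B := by linarith
    positivity
  set deg : V → ℝ := fun v => prob P {t | v ∈ S t} with hdeg
  set K : ℕ → Finset V := fun j => Finset.univ.filter fun v => 1 ≤ d j * deg v with hK
  have hKmono : Monotone K := fun a b hab v hv => by
    simp only [hK, Finset.mem_filter, Finset.mem_univ, true_and] at hv ⊢
    exact hv.trans (mul_le_mul_of_nonneg_right (hdmono hab) (prob_nonneg P _))
  have hKcard : ∀ j, ((K j).card : ℝ) ≤ q * d j := fun j => by
    calc ((K j).card : ℝ) = ∑ _v ∈ K j, 1 := by simp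
      _ ≤ ∑ v ∈ K j, d j * deg v := Finset.sum_le_sum fun v hv => (Finset.mem_filter.1 hv).2
      _ = d j * ∑ v ∈ K j, deg v := (Finset.mul_sum _ _ _).symm
      _ ≤ d j * q := by
          refine mul_le_mul_of_nonneg_left (sum_prob_le P _ _ q fun t ht A' _ hA' => ?_) (hd0 j).le
          exact (Finset.card_le_card fun v hv => hA' v hv).trans (hS t ht)
      _ = q * d j := mul_comm _ _
  obtain ⟨j, hj, hlayer⟩ := exists_layer_prob_le P S hq hS K hKmono
  refine ⟨K j, (hKcard j).trans ?_, fun G hG F hF₁ hF₀ => ?_⟩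
  · exact mul_le_mul_of_nonneg_left (hdmono (by omega)) (by linarith)
  -- `5 / 12 = 2 / 3 - 1 / 4`: the trees of `G` that avoid the sparse layer.
  have hG' : 5 / 12 ≤ prob P {t | t ∈ G ∧ t ∈ P.support ∧ Disjoint (S t) (K (j + 1) \ K j)} := by
    have h1 : prob P G ≤ prob P ({t | t ∈ G ∧ t ∈ P.support ∧
        Disjoint (S t) (K (j + 1) \ K j)} ∪ {t | ¬ Disjoint (S t) (K (j + 1) \ K j)}) := by
      refine prob_mono P fun t ht => ?_
      by_cases h : Disjoint (S t) (K (j + 1) \ K j)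
      · exact Or.inl ⟨ht.1, ht.2, h⟩
      · exact Or.inr h
    have h2 := h1.trans (prob_union_le P _ _)
    linarith
  have hmain := subsetExp_no_cover_le P S hq hS (inv_pos.2 hN0) (inv_le_one_of_one_le₀ hN) (K j)
    (K (j + 1)) (hd0 (j + 1)) (fun v hv => by
      by_contra! hlt
      exact hv (Finset.mem_filter.2 ⟨Finset.mem_univ v, hlt.le⟩))
    _ (fun t ht => ht.2.1) hG' (fun t ht => ht.2.2) hF₁
    (fun R t ht hR => hF₀ R t ht.1 ht.2.1 hR)
  have hexp : 2 * (q * d j) ≤ N⁻¹ ^ q * (5 * d (j + 1) / (12 * q)) := by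
    have heq : N⁻¹ ^ q * (5 * d (j + 1) / (12 * q)) = 25 / 12 * (q * d j) := by
      simp only [hd, pow_succ B, inv_pow]
      nth_rewrite 2 [hB]
      field_simp
      ring
    rw [heq]
    have : 0 < q * d j := mul_pos (by linarith) (hd0 j)
    linarith
  have htwo : (2 : ℝ) ^ (K j).card ≤ Real.exp (q * d j) := by
    calc (2 : ℝ) ^ (K j).card ≤ Real.exp 1 ^ (K j).card := by
          gcongr
          linarith [Real.add_one_le_exp (1 : ℝ)]
      _ = Real.exp (K j).card := by rw [← Real.exp_nat_mul, mul_one]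
      _ ≤ _ := Real.exp_le_exp.2 (hKcard j)
  have hNd : N ≤ q * d j := by
    have h1 : N ≤ d j := by
      simp only [hd]
      exact le_mul_of_one_le_right hN0.le (one_le_pow₀ hB1)
    exact h1.trans (le_mul_of_one_le_left (hd0 j).le hq1)
  calc (2 : ℝ) ^ (K j).card * subsetExp N⁻¹ F
      ≤ 2 ^ (K j).card * Real.exp (-(2 * (q * d j))) := by
        gcongr
        exact hmain.trans (Real.exp_le_exp.2 (neg_le_neg hexp))
    _ ≤ Real.exp (q * d j) * Real.exp (-(2 * (q * d j))) := by gcongr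
    _ = Real.exp (-(q * d j)) := by rw [← Real.exp_add]; ring_nf
    _ ≤ Real.exp (-N) := Real.exp_le_exp.2 (neg_le_neg hNd)

end Kernel

/-! ### Decoding all message bits from a random part of the codeword -/

section Decoder

variable {k n : ℕ} {C : Str k → Str n} {δ : ℝ} {D : LocalDecoder k n}

theorem IsRelaxedDecoder.eval_eq (h : IsRelaxedDecoder C δ D) (x : Str k) (i : Fin k)
    {t : DecisionTree n} (ht : t ∈ (D i).support) : t.eval (C x) = some (x i) := by
  have h1 := (PMF.apply_eq_one_iff _ _).1 (h.completeness x i)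
  have h2 : t.eval (C x) ∈ (D.output (C x) i).support := by
    rw [LocalDecoder.output, PMF.support_map]
    exact Set.mem_image_of_mem _ ht
  rwa [h1] at h2

/-- This puts relaxed decoding into the form of an event to which `exists_kernel` applies. -/
theorem IsRelaxedDecoder.prob_eval_ne (h : IsRelaxedDecoder C δ D) {x : Str k} {w : Str n}
    (hw : relDist w (C x) ≤ δ) (i : Fin k) :
    2 / 3 ≤ prob (D i) {t | t.eval w ≠ some (!x i)} := by
  have h1 : D.output w i (some (x i)) + D.output w i none =
      (D i).toOuterMeasure {t | t.eval w ≠ some (!x i)} := by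
    have h2 : D.output w i (some (x i)) + D.output w i none =
        (D.output w i).toOuterMeasure ↑({some (x i), none} : Finset (Option Bool)) := by
      rw [PMF.toOuterMeasure_apply_finset, Finset.sum_pair (by simp)]
    rw [h2, LocalDecoder.output, PMF.toOuterMeasure_map_apply]
    congr 1
    ext t
    rcases ht : t.eval w with _ | b
    · simp [ht]
    · cases b <;> cases hx : x i <;> simp [ht]
  have h3 := h.relaxed_decoding x w hw i
  rw [h1] at h3
  have h4 := ENNReal.toReal_mono (toOuterMeasure_ne_top _ _) h3
  simpa [prob] using h4

/-- The word `y`, with the coordinates in `K` replaced by the indicator function of `B`. -/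
def overwrite (K B : Finset (Fin n)) (y : Str n) : Str n :=
  fun v => if v ∈ K then decide (v ∈ B) else y v

theorem relDist_overwrite_le {K : Finset (Fin n)} (hK : (K.card : ℝ) ≤ δ * n) (hδ : 0 ≤ δ)
    (B : Finset (Fin n)) (y : Str n) : relDist (overwrite K B y) y ≤ δ := by
  refine div_le_of_le_mul₀ (Nat.cast_nonneg n) hδ (le_trans ?_ hK)
  refine Nat.cast_le.2 (Finset.card_le_card fun v hv => ?_)
  by_contra hvK
  simp [overwrite, hvK] at hv

/-- The coordinates in `R` refute all wrong values of the message `x`: whatever values are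
assigned to the kernels `K i`, some tree that queries only `R ∪ K i` does not output the wrong
value of `x i`. -/
def Determines (C : Str k → Str n) (D : LocalDecoder k n) (K : Fin k → Finset (Fin n))
    (R : Finset (Fin n)) (x : Str k) : Prop :=
  ∀ i, ∀ B ∈ (K i).powerset, ∃ t ∈ (D i).support, t.coords ⊆ R ∪ K i ∧
    t.eval (overwrite (K i) B (C x)) ≠ some (!x i)

/-- If `x i ≠ y i`, guess the values of `C y` on `K i`. The refuting tree then sees only values of
`C y`, and perfect completeness forces it to output `y i`, the very bit it refutes. -/
theorem Determines.eq (h : IsRelaxedDecoder C δ D) {K : Fin k → Finset (Fin n)}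
    {R : Finset (Fin n)} {x y : Str k} (hx : Determines C D K R x)
    (hxy : ∀ v ∈ R, C x v = C y v) : x = y := by
  by_contra hne
  obtain ⟨i, hi⟩ := Function.ne_iff.1 hne
  obtain ⟨t, ht, htR, hte⟩ := hx i ((K i).filter fun v => C y v = true)
    (Finset.mem_powerset.2 (Finset.filter_subset _ _))
  refine hte ?_
  rw [t.eval_congr_coords (w' := C y) fun v hv => ?_, h.eval_eq y i ht]
  · cases hxi : x i <;> cases hyi : y i <;> simp_all
  · by_cases hvK : v ∈ K i
    · simp [overwrite, hvK]
    · have hvR : v ∈ R := (Finset.mem_union.1 (htR hv)).resolve_right hvK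
      simp [overwrite, hvK, hxy v hvR]

open Classical in
theorem card_determines_le (h : IsRelaxedDecoder C δ D) (K : Fin k → Finset (Fin n))
    (R : Finset (Fin n)) :
    (Finset.univ.filter (Determines C D K R)).card ≤ 2 ^ R.card := by
  rw [← Finset.card_powerset]
  refine Finset.card_le_card_of_injOn (fun x => R.filter fun v => C x v = true)
    (fun x _ => Finset.mem_coe.2 (Finset.mem_powerset.2 (Finset.filter_subset _ _)))
    fun x hx y _ hxy => ?_
  refine Determines.eq h (Finset.mem_filter.1 (Finset.mem_coe.1 hx)).2 fun v hv => ?_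
  have hmem := Finset.ext_iff.1 hxy v
  simp only [Finset.mem_filter, hv, true_and] at hmem
  exact Bool.eq_iff_iff.2 hmem

-- A union bound: for each `i`, all guesses together fail with probability at most `exp (-N)`, and
-- `k * exp (-N) ≤ 1 / 2`.
open Classical in
theorem half_le_subsetExp_determines (h : IsRelaxedDecoder C δ D) (hδ : 0 ≤ δ) {N : ℝ}
    {K : Fin k → Finset (Fin n)} (hN : 1 ≤ N) (hkN : 2 * k ≤ Real.exp N)
    (hKδ : ∀ i, ((K i).card : ℝ) ≤ δ * n)
    (hK : ∀ i, ∀ G : Set (DecisionTree n), 2 / 3 ≤ prob (D i) G →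
      ∀ F : Finset (Fin n) → ℝ, (∀ R, F R ≤ 1) →
        (∀ R, ∀ t ∈ G, t ∈ (D i).support → t.coords ⊆ R ∪ K i → F R ≤ 0) →
        2 ^ (K i).card * subsetExp N⁻¹ F ≤ Real.exp (-N)) (x : Str k) :
    1 / 2 ≤ subsetExp N⁻¹ fun R => if Determines C D K R x then 1 else 0 := by
  set bad : Fin k → Finset (Fin n) → Finset (Fin n) → ℝ := fun i B R =>
    if ∃ t ∈ (D i).support, t.coords ⊆ R ∪ K i ∧
      t.eval (overwrite (K i) B (C x)) ≠ some (!x i) then 0 else 1 with hbad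
  have hbad0 : ∀ i B R, 0 ≤ bad i B R := fun i B R => by
    simp only [hbad]
    split_ifs <;> norm_num
  have hbit : ∀ i, ∑ B ∈ (K i).powerset, subsetExp N⁻¹ (bad i B) ≤ Real.exp (-N) := fun i => by
    have h2 : (0 : ℝ) < 2 ^ (K i).card := by positivity
    calc ∑ B ∈ (K i).powerset, subsetExp N⁻¹ (bad i B)
        ≤ ∑ _B ∈ (K i).powerset, Real.exp (-N) / 2 ^ (K i).card := by
          refine Finset.sum_le_sum fun B _ => ?_
          rw [le_div_iff₀' h2]
          -- The kernel is small enough that every guess keeps the word within radius `δ` of `C x`.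
          refine hK i _ (h.prob_eval_ne (relDist_overwrite_le (hKδ i) hδ B (C x)) i) _
            (fun R => ?_) fun R t htG ht htR => ?_
          · simp only [hbad]
            split_ifs <;> norm_num
          · simp only [hbad]
            rw [if_pos ⟨t, ht, htR, htG⟩]
      _ = Real.exp (-N) := by
          rw [Finset.sum_const, Finset.card_powerset, nsmul_eq_mul]
          push_cast
          field_simp
  have hle : subsetExp N⁻¹ (fun R => 1 - if Determines C D K R x then (1 : ℝ) else 0) ≤
      subsetExp N⁻¹ fun R => ∑ i, ∑ B ∈ (K i).powerset, bad i B R := by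
    refine subsetExp_mono (by positivity) (inv_le_one_of_one_le₀ hN) fun R => ?_
    split_ifs with hR
    · rw [sub_self]
      exact Finset.sum_nonneg fun i _ => Finset.sum_nonneg fun B _ => hbad0 i B R
    · rw [Determines] at hR
      push Not at hR
      obtain ⟨i, B, hB, hiB⟩ := hR
      have h1 : bad i B R = 1 := by
        simp only [hbad]
        rw [if_neg]
        rintro ⟨t, ht, htR, hte⟩
        exact hte (hiB t ht htR)
      rw [sub_zero, ← h1]
      exact (Finset.single_le_sum (f := fun B => bad i B R) (fun B _ => hbad0 i B R) hB).trans
        (Finset.single_le_sum (f := fun i => ∑ B ∈ (K i).powerset, bad i B R)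
          (fun i _ => Finset.sum_nonneg fun B _ => hbad0 i B R) (Finset.mem_univ i))
  rw [subsetExp_sub, subsetExp_const, subsetExp_sum] at hle
  simp only [subsetExp_sum] at hle
  have htot : ∑ i : Fin k, ∑ B ∈ (K i).powerset, subsetExp N⁻¹ (bad i B) ≤
      k * Real.exp (-N) := by
    calc _ ≤ ∑ _i : Fin k, Real.exp (-N) := Finset.sum_le_sum fun i _ => hbit i
      _ = _ := by simp
  have hk : k * Real.exp (-N) ≤ 1 / 2 := by
    rw [Real.exp_neg, ← div_eq_mul_inv, div_le_iff₀ (Real.exp_pos N)]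
    linarith
  linarith

/-- If the decoder queries at most `q` coordinates for each outcome of its coins, then the message
is determined by about `n / N` coordinates of the codeword. -/
theorem two_pow_le_exp (h : IsRelaxedDecoder C δ D) (hδ : 0 ≤ δ) {q : ℕ} (hq : 1 ≤ q)
    (hD : ∀ i, ∀ t ∈ (D i).support, t.coords.card ≤ q) {N : ℝ} (hN : 1 ≤ N)
    (hkN : 2 * k ≤ Real.exp N)
    (hn : q * (N * (5 * q ^ 2 * N ^ q) ^ (4 * q - 1)) ≤ δ * n) :
    (2 : ℝ) ^ k / 2 ≤ Real.exp (n / N) := by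
  classical
  choose K hKcard hK using fun i =>
    exists_kernel (D i) DecisionTree.coords hq (hD i) hN
  have hx := half_le_subsetExp_determines h hδ hN hkN (fun i => (hKcard i).trans hn) hK
  calc (2 : ℝ) ^ k / 2 = ∑ _x : Str k, (1 / 2 : ℝ) := by
        simp [div_eq_mul_inv]
    _ ≤ ∑ x : Str k, subsetExp N⁻¹ fun R => if Determines C D K R x then 1 else 0 :=
        Finset.sum_le_sum fun x _ => hx x
    _ = subsetExp N⁻¹ fun R => ∑ x : Str k, if Determines C D K R x then 1 else 0 :=
        (subsetExp_sum _ _ _).symm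
    _ ≤ subsetExp N⁻¹ fun R => 2 ^ R.card := by
        refine subsetExp_mono (by positivity) (inv_le_one_of_one_le₀ hN) fun R => ?_
        rw [Finset.sum_boole]
        exact_mod_cast card_determines_le h K R
    _ = (1 + N⁻¹) ^ n := by rw [subsetExp_two_pow_card, Fintype.card_fin]
    _ ≤ Real.exp N⁻¹ ^ n := by
        gcongr
        linarith [Real.add_one_le_exp N⁻¹]
    _ = Real.exp (n / N) := by rw [← Real.exp_nat_mul, div_eq_mul_inv]

theorem le_of_injective_code (hC : Function.Injective C) : k ≤ n := by
  have h := Fintype.card_le_of_injective C hC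
  simp only [Fintype.card_fun, Fintype.card_bool, Fintype.card_fin] at h
  exact (Nat.pow_le_pow_iff_right (by norm_num)).1 h

theorem le_four_mul_of_two_pow_le_exp {a : ℝ} (ha : 1 ≤ a) (h : (2 : ℝ) ^ k / 2 ≤ Real.exp a) :
    (k : ℝ) ≤ 4 * a := by
  have h1 := Real.log_le_log (by positivity) h
  rw [Real.log_exp, Real.log_div (by positivity) (by norm_num), Real.log_pow] at h1
  have h2 := Real.log_two_gt_d9
  have h3 := Real.log_two_lt_d9
  nlinarith [Nat.cast_nonneg (α := ℝ) k]

end Decoder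

/-! ### The lower bounds -/

/-- With `n = N ^ (4 * q ^ 2 + 1)`, the first bound serves the union bound over the `k ≤ n` indices,
and the second keeps the kernels below `δ * n`. -/
theorem exists_large_param (q : ℕ) {δ : ℝ} (hδ : 0 < δ) :
    ∃ N₀ : ℝ, 1 ≤ N₀ ∧ ∀ N, N₀ ≤ N → 2 * N ^ (4 * q ^ 2 + 1) ≤ Real.exp N ∧
      q * (5 * q ^ 2) ^ (4 * q - 1) ≤ δ * N := by
  have h1 : ∀ᶠ N : ℝ in atTop, N ^ (4 * q ^ 2 + 1) * Real.exp (-N) < 1 / 2 :=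
    (Real.tendsto_pow_mul_exp_neg_atTop_nhds_zero _).eventually_lt_const (by norm_num)
  have h2 : ∀ᶠ N : ℝ in atTop, q * (5 * q ^ 2) ^ (4 * q - 1) / δ ≤ N := eventually_ge_atTop _
  obtain ⟨N₀, hN₀⟩ := eventually_atTop.1 (h1.and h2)
  refine ⟨max 1 N₀, le_max_left _ _, fun N hN => ?_⟩
  obtain ⟨h3, h4⟩ := hN₀ N ((le_max_right _ _).trans hN)
  constructor
  · rw [Real.exp_neg, ← div_eq_mul_inv, div_lt_iff₀ (Real.exp_pos N)] at h3
    linarith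
  · rw [div_le_iff₀ hδ] at h4
    linarith

/-- The lower bound for decoders that depend on at most `q` coordinates for each outcome of their
coins. -/
theorem exists_const_mul_rpow_le {q : ℕ} (hq : 1 ≤ q) {δ : ℝ} (hδ : 0 < δ) :
    ∃ c : ℝ, 0 < c ∧ ∀ (k n : ℕ) (C : Str k → Str n) (D : LocalDecoder k n),
      Function.Injective C → IsRelaxedDecoder C δ D →
      (∀ i, ∀ t ∈ (D i).support, t.coords.card ≤ q) →
      c * (k : ℝ) ^ (1 + 1 / (4 * (q : ℝ) ^ 2)) ≤ n := by
  obtain ⟨N₀, hN₀1, hN₀⟩ := exists_large_param q hδ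
  have hq1 : (1 : ℝ) ≤ q := by exact_mod_cast hq
  have hQ : (4 : ℝ) ≤ 4 * (q : ℝ) ^ 2 := by nlinarith
  have hQ0 : (0 : ℝ) < 4 * (q : ℝ) ^ 2 := by linarith
  have hexp : 1 + 1 / (4 * (q : ℝ) ^ 2) ≤ 2 := by
    have : 1 / (4 * (q : ℝ) ^ 2) ≤ 1 := by
      rw [div_le_one hQ0]
      linarith
    linarith
  have hexp0 : 0 < 1 + 1 / (4 * (q : ℝ) ^ 2) := by positivity
  have hpos : 0 < 16 + N₀ ^ (4 * q ^ 2 + 1) := by positivity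
  -- `16 = 4 ^ 2` absorbs the factor in `k ≤ 4 * n / N` when `N₀ ≤ N`; the other term covers small
  -- `n`, through `k ^ 2 ≤ n * n`.
  refine ⟨(16 + N₀ ^ (4 * q ^ 2 + 1))⁻¹, inv_pos.2 hpos, fun k n C D hC h hD => ?_⟩
  rw [inv_mul_le_iff₀ hpos]
  rcases Nat.eq_zero_or_pos k with rfl | hk
  · rw [Nat.cast_zero, Real.zero_rpow hexp0.ne']
    positivity
  have hkn : (k : ℝ) ≤ n := by exact_mod_cast le_of_injective_code hC
  have hk1 : (1 : ℝ) ≤ k := by exact_mod_cast hk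
  set N : ℝ := (n : ℝ) ^ (1 / ((4 * q ^ 2 + 1 : ℕ) : ℝ)) with hN
  have hNpow : N ^ (4 * q ^ 2 + 1) = n := by
    rw [hN, one_div, Real.rpow_inv_natCast_pow (Nat.cast_nonneg n) (by omega)]
  have hN0 : 0 ≤ N := by positivity
  by_cases hNN : N₀ ≤ N
  · have hN1 : 1 ≤ N := hN₀1.trans hNN
    obtain ⟨h1, h2⟩ := hN₀ N hNN
    have hmain := two_pow_le_exp h hδ.le hq hD hN1 (by rw [hNpow] at h1; linarith) (by
      calc (q : ℝ) * (N * (5 * q ^ 2 * N ^ q) ^ (4 * q - 1))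
          = q * (5 * q ^ 2) ^ (4 * q - 1) * (N * N ^ (q * (4 * q - 1))) := by
            rw [mul_pow, pow_mul]
            ring
        _ ≤ δ * N * (N * N ^ (q * (4 * q - 1))) := by gcongr
        _ = δ * N ^ (q * (4 * q - 1) + 2) := by ring
        _ ≤ δ * N ^ (4 * q ^ 2 + 1) := by
            refine mul_le_mul_of_nonneg_left (pow_le_pow_right₀ hN1 ?_) hδ.le
            obtain ⟨m, rfl⟩ : ∃ m, q = m + 1 := ⟨q - 1, by omega⟩
            rw [show 4 * (m + 1) - 1 = 4 * m + 3 by omega]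
            nlinarith
        _ = δ * n := by rw [hNpow])
    have hnN : (n : ℝ) / N = N ^ (4 * q ^ 2) := by
      rw [← hNpow, pow_succ, mul_div_assoc, div_self (by linarith), mul_one]
    rw [hnN] at hmain
    have hk4 := le_four_mul_of_two_pow_le_exp (one_le_pow₀ hN1) hmain
    calc (k : ℝ) ^ (1 + 1 / (4 * (q : ℝ) ^ 2))
        ≤ ((4 : ℝ) * N ^ (4 * q ^ 2)) ^ (1 + 1 / (4 * (q : ℝ) ^ 2)) := by gcongr
      _ = (4 : ℝ) ^ (1 + 1 / (4 * (q : ℝ) ^ 2)) * n := by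
          rw [Real.mul_rpow (by norm_num) (by positivity), ← hNpow, ← Real.rpow_natCast N,
            ← Real.rpow_natCast N, ← Real.rpow_mul hN0]
          congr 2
          push_cast
          field_simp
      _ ≤ (4 : ℝ) ^ (2 : ℝ) * n := by
          gcongr
          norm_num
      _ ≤ (16 + N₀ ^ (4 * q ^ 2 + 1)) * n := by
          have : 0 ≤ N₀ ^ (4 * q ^ 2 + 1) := by positivity
          gcongr
          norm_num
          linarith
  · have hn : (n : ℝ) ≤ N₀ ^ (4 * q ^ 2 + 1) := by
      rw [← hNpow]
      gcongr
      exact (not_le.1 hNN).le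
    calc (k : ℝ) ^ (1 + 1 / (4 * (q : ℝ) ^ 2)) ≤ (k : ℝ) ^ (2 : ℝ) :=
          Real.rpow_le_rpow_of_exponent_le hk1 hexp
      _ = k * k := by rw [Real.rpow_two, sq]
      _ ≤ N₀ ^ (4 * q ^ 2 + 1) * n := by
          gcongr
          exact hkn.trans hn
      _ ≤ (16 + N₀ ^ (4 * q ^ 2 + 1)) * n := by
          gcongr
          linarith

theorem const_mul_rpow_le_of_exponent_le {c a b : ℝ} (hc : 0 ≤ c) (ha : 0 < a) (hab : a ≤ b)
    {k n : ℕ} (h : c * (k : ℝ) ^ b ≤ n) : c * (k : ℝ) ^ a ≤ n := by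
  rcases Nat.eq_zero_or_pos k with rfl | hk
  · rw [Nat.cast_zero, Real.zero_rpow ha.ne', mul_zero]
    positivity
  · exact (mul_le_mul_of_nonneg_left
      (Real.rpow_le_rpow_of_exponent_le (by exact_mod_cast hk) hab) hc).trans h

theorem exists_const_adaptive (ℓ : ℕ) {δ : ℝ} (hδ : 0 < δ) :
    ∃ c : ℝ, 0 < c ∧ ∀ (k n : ℕ) (C : Str k → Str n), IsRelaxedLDC C ℓ δ →
      c * (k : ℝ) ^ (1 + 1 / (4 * ((2 : ℝ) ^ ℓ) ^ 2)) ≤ n := by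
  obtain ⟨c, hc, h⟩ := exists_const_mul_rpow_le (Nat.one_le_two_pow (n := ℓ)) hδ
  refine ⟨c, hc, ?_⟩
  rintro k n C ⟨hC, D, hD, hℓ⟩
  have := h k n C D hC.injective hD fun i t ht =>
    DecisionTree.card_coords_le_two_pow (hℓ i t ht)
  exact_mod_cast this

/-- Here `q = ℓ + 1` rather than `ℓ`, so that `1 ≤ q` also when `ℓ = 0`. -/
theorem exists_const_nonadaptive (ℓ : ℕ) {δ : ℝ} (hδ : 0 < δ) :
    ∃ c : ℝ, 0 < c ∧ ∀ (k n : ℕ) (C : Str k → Str n), IsNonadaptiveRelaxedLDC C ℓ δ →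
      c * (k : ℝ) ^ (1 + 1 / (4 * ((ℓ : ℝ) + 1) ^ 2)) ≤ n := by
  obtain ⟨c, hc, h⟩ := exists_const_mul_rpow_le (Nat.succ_le_succ (Nat.zero_le ℓ)) hδ
  refine ⟨c, hc, ?_⟩
  rintro k n C ⟨hC, D, hD, hℓ, hna⟩
  have := h k n C D hC.injective hD fun i t ht =>
    (DecisionTree.card_coords_le_of_nonadaptive (hna i t ht) (hℓ i t ht)).trans (Nat.le_succ ℓ)
  exact_mod_cast this

/-- A lower bound `c * k ^ (1 + α)` excludes blocklength `k ^ (1 + o(1))`. -/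
theorem not_le_rpow_one_add {c α : ℝ} (hc : 0 < c) (hα : 0 < α) {k n : ℕ → ℕ} {ε : ℕ → ℝ}
    (hk : Tendsto k atTop atTop) (hε : Tendsto ε atTop (𝓝 0))
    (hlow : ∀ m, c * (k m : ℝ) ^ (1 + α) ≤ n m) (hup : ∀ m, (n m : ℝ) ≤ (k m : ℝ) ^ (1 + ε m)) :
    False := by
  have h1 : ∀ᶠ m in atTop, ε m < α / 2 := hε.eventually_lt_const (by linarith)
  have h2 : Tendsto (fun m => (k m : ℝ) ^ (α / 2)) atTop atTop :=
    (tendsto_rpow_atTop (by linarith)).comp (tendsto_natCast_atTop_atTop.comp hk)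
  obtain ⟨m, h3, h4, h5⟩ := (h1.and ((h2.eventually_gt_atTop c⁻¹).and
    (hk.eventually_ge_atTop 1))).exists
  have hk1 : (1 : ℝ) ≤ k m := by exact_mod_cast h5
  have hk0 : (0 : ℝ) < k m := by linarith
  have h6 : c * (k m : ℝ) ^ (1 + α) ≤ (k m : ℝ) ^ (1 + α / 2) :=
    ((hlow m).trans (hup m)).trans (Real.rpow_le_rpow_of_exponent_le hk1 (by linarith))
  rw [show 1 + α = (1 + α / 2) + α / 2 by ring, Real.rpow_add hk0] at h6
  have h7 : 0 < (k m : ℝ) ^ (1 + α / 2) := by positivity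
  have h8 : 1 < c * (k m : ℝ) ^ (α / 2) := by
    rwa [inv_lt_iff_one_lt_mul₀' hc] at h4
  nlinarith

end RLDC

theorem theorem1 :
    -- every locality and decoding radius has an exponent `1 + α` with `α > 0`
    (∀ (ℓ : ℕ) (δ : ℝ), 0 < δ → ∃ α : ℝ, 0 < α ∧ ∃ c : ℝ, 0 < c ∧
      ∀ (k n : ℕ) (C : RLDC.Str k → RLDC.Str n), RLDC.IsRelaxedLDC C ℓ δ →
        c * (k : ℝ) ^ (1 + α) ≤ (n : ℝ)) ∧
    -- the explicit exponent
    (∃ L : ℕ → ℕ, (∀ ℓ, 1 ≤ L ℓ) ∧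
      ((fun ℓ : ℕ => (L ℓ : ℝ)) =O[atTop] fun ℓ : ℕ => (2 : ℝ) ^ ℓ * Real.log ℓ) ∧
      ∀ (ℓ : ℕ) (δ : ℝ), 0 < δ → ∃ c : ℝ, 0 < c ∧
        ∀ (k n : ℕ) (C : RLDC.Str k → RLDC.Str n), RLDC.IsRelaxedLDC C ℓ δ →
          c * (k : ℝ) ^ (2 * (L ℓ : ℝ) ^ 2 / (2 * (L ℓ : ℝ) ^ 2 - 1)) ≤ (n : ℝ)) ∧
    -- non-adaptive decoders
    (∃ A : ℕ → ℝ, (∀ ℓ, 0 < A ℓ) ∧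
      (A =O[atTop] fun ℓ : ℕ => (ℓ : ℝ) ^ 2) ∧
      ∀ (ℓ : ℕ) (δ : ℝ), 0 < δ → ∃ c : ℝ, 0 < c ∧
        ∀ (k n : ℕ) (C : RLDC.Str k → RLDC.Str n), RLDC.IsNonadaptiveRelaxedLDC C ℓ δ →
          c * (k : ℝ) ^ (1 + 1 / A ℓ) ≤ (n : ℝ)) ∧
    -- no family of codes with constant locality and radius has blocklength `k ^ (1 + o(1))`
    (∀ (ℓ : ℕ) (δ : ℝ), 0 < δ →
      ¬ ∃ (k n : ℕ → ℕ) (C : ∀ m, RLDC.Str (k m) → RLDC.Str (n m)) (ε : ℕ → ℝ),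
        Tendsto k atTop atTop ∧ Tendsto ε atTop (𝓝 0) ∧
        ∀ m, RLDC.IsRelaxedLDC (C m) ℓ δ ∧ (n m : ℝ) ≤ (k m : ℝ) ^ (1 + ε m)) := by
  -- With `L = 2 * 2 ^ ℓ`, `2 * L ^ 2 - 1` is at least `4 * (2 ^ ℓ) ^ 2`, so the explicit exponent
  -- is at most the one proved.
  refine ⟨fun ℓ δ hδ => ?_, ⟨fun ℓ => 2 * 2 ^ ℓ, fun ℓ => ?_, ?_, fun ℓ δ hδ => ?_⟩,
    ⟨fun ℓ => 4 * ((ℓ : ℝ) + 1) ^ 2, fun ℓ => by positivity, ?_, fun ℓ δ hδ =>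
      RLDC.exists_const_nonadaptive ℓ hδ⟩, fun ℓ δ hδ => ?_⟩
  · exact ⟨1 / (4 * ((2 : ℝ) ^ ℓ) ^ 2), by positivity, RLDC.exists_const_adaptive ℓ hδ⟩
  · exact one_le_mul (by norm_num) Nat.one_le_two_pow
  · refine IsBigO.of_bound 2 ?_
    filter_upwards [eventually_ge_atTop 3] with ℓ hℓ
    have h3 : (3 : ℝ) ≤ ℓ := by exact_mod_cast hℓ
    have hlog : 1 ≤ Real.log ℓ := by
      rw [Real.le_log_iff_exp_le (by linarith)]
      linarith [Real.exp_one_lt_d9]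
    have hpow : (0 : ℝ) < 2 ^ ℓ := by positivity
    rw [Real.norm_of_nonneg (by positivity), Real.norm_of_nonneg (by positivity)]
    push_cast
    nlinarith
  · obtain ⟨c, hc, h⟩ := RLDC.exists_const_adaptive ℓ hδ
    refine ⟨c, hc, fun k n C hC => ?_⟩
    have hpow : (1 : ℝ) ≤ 2 ^ ℓ := one_le_pow₀ (by norm_num)
    have hden : 4 * ((2 : ℝ) ^ ℓ) ^ 2 ≤ 2 * (2 * (2 : ℝ) ^ ℓ) ^ 2 - 1 := by nlinarith
    have hden0 : (0 : ℝ) < 4 * ((2 : ℝ) ^ ℓ) ^ 2 := by positivity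
    push_cast
    refine RLDC.const_mul_rpow_le_of_exponent_le hc.le (div_pos (by positivity) (by linarith)) ?_
      (h k n C hC)
    calc 2 * (2 * (2 : ℝ) ^ ℓ) ^ 2 / (2 * (2 * (2 : ℝ) ^ ℓ) ^ 2 - 1)
        = 1 + 1 / (2 * (2 * (2 : ℝ) ^ ℓ) ^ 2 - 1) := by
          rw [eq_comm, one_add_div (by linarith)]
          ring_nf
      _ ≤ 1 + 1 / (4 * ((2 : ℝ) ^ ℓ) ^ 2) := by gcongr
  · refine IsBigO.of_bound 16 ?_
    filter_upwards [eventually_ge_atTop 1] with ℓ hℓ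
    have h1 : (1 : ℝ) ≤ ℓ := by exact_mod_cast hℓ
    rw [Real.norm_of_nonneg (by positivity), Real.norm_of_nonneg (by positivity)]
    nlinarith
  · rintro ⟨k, n, C, ε, hk, hε, h⟩
    obtain ⟨c, hc, hlow⟩ := RLDC.exists_const_adaptive ℓ hδ
    exact RLDC.not_le_rpow_one_add hc (by positivity) hk hε
      (fun m => hlow (k m) (n m) (C m) (h m).1) fun m => (h m).2
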